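/- Let $\mathbb{K}=\mathbb{R}$ or $\mathbb{C}$. Let $2Nilp_8(\mathbb{K})$ be the algebraic variety of Lie brackets $\mu$ on $\mathbb{K}^8$ with $\mu(x,\mu(y,z))=0$ for all $x,y,z$ (at most $2$-step nilpotent Lie brackets), regarded as a subset of the affine space of structure constants $(C_{ij}^k)\in\mathbb{K}^{8\times 8\times 8}$, $\mu(e_i,e_j)=\sum_k C_{ij}^k e_k$. The group $GL_8(\mathbb{K})$ acts on it by $(g\cdot\mu)(x,y)=g\,\mu(g^{-1}x,g^{-1}y)$; the orbit of $\mu$ consists of the brackets isomorphic to $\mu$. Let $\mathfrak{k}_8$ be the Lie algebra on $\mathbb{K}^8$, with standard basis $X_1,\dots,X_8$ and dual basis $\alpha_1,\dots,\alpha_8$, defined by the Maurer–Cartan equations $$d\alpha_3=\alpha_1\wedge\alpha_2+\alpha_4\wedge\alpha_6+\alpha_7\wedge\alpha_8,\qquad d\alpha_5=\alpha_1\wedge\alpha_4+\alpha_2\wedge\alpha_8+\alpha_6\wedge\alpha_7,\qquad d\alpha_i=0\ (i\neq 3,5),$$ where $d\alpha(X,Y)=-\alpha([X,Y])$. **Proposition.**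 The Lie algebra $\mathfrak{k}_8$ is rigid in $2Nilp_8$, that is, its orbit is open. More precisely, for $\mathbb{K}=\mathbb{C}$ the orbit of $\mathfrak{k}_8$ is open in $2Nilp_8(\mathbb{C})$ for the Zariski topology and for the classical (metric) topology, and for $\mathbb{K}=\mathbb{R}$ the orbit of $\mathfrak{k}_8$ is open in $2Nilp_8(\mathbb{R})$ for the classical topology. -/

import Mathlib

open scoped Topology

noncomputable section

/-- The underlying vector space `K^n`. -/
abbrev Vec (K : Type*) (n : ℕ) : Type _ := Fin n → K

/-- Bilinear products `K^n × K^n → K^n`. -/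
abbrev BilinProduct (K : Type*) [Field K] (n : ℕ) : Type _ :=
  Vec K n →ₗ[K] Vec K n →ₗ[K] Vec K n

/-- `μ` is a Lie bracket on `K^n`: it is alternating and satisfies the Jacobi identity. -/
structure IsLieBracket {K : Type*} [Field K] {n : ℕ} (μ : BilinProduct K n) : Prop where
  alt : ∀ x, μ x x = 0
  jacobi : ∀ x y z, μ (μ x y) z + μ (μ y z) x + μ (μ z x) y = 0

/-- The set `2Nilp_n` of Lie brackets `μ` on `K^n` with `C^2(μ) = [K^n, [K^n, K^n]] = 0`.
The abelian bracket is included, which makes this an algebraic variety. -/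
def TwoNilp (K : Type*) [Field K] (n : ℕ) : Type _ :=
  {μ : BilinProduct K n // IsLieBracket μ ∧ ∀ x y z, μ x (μ y z) = 0}

/-- Index set of the structure constants. -/
abbrev StrIndex (n : ℕ) : Type := Fin n × Fin n × Fin n

/-- The structure constants `C_{ij}^k` of `μ`, given by `μ(e_i, e_j) = ∑ k, C_{ij}^k e_k`. -/
def strConst {K : Type*} [Field K] {n : ℕ} (μ : BilinProduct K n) : StrIndex n → K :=
  fun t => μ (Pi.single t.1 1) (Pi.single t.2.1 1) t.2.2

/-- The Zariski topology on the affine space `K^σ`: the closed sets are the sets of common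
zeros of families of polynomials. -/
abbrev zariskiAffine (σ K : Type*) [Field K] : TopologicalSpace (σ → K) :=
  TopologicalSpace.ofClosed
    {Z | ∃ S : Set (MvPolynomial σ K), Z = {x | ∀ p ∈ S, MvPolynomial.eval x p = 0}}
    ⟨{1}, by ext x; simp⟩
    (by
      intro A hA
      refine ⟨{p | ∃ Z ∈ A, ∀ x ∈ Z, MvPolynomial.eval x p = 0}, ?_⟩
      ext x
      constructor
      · rintro hx p ⟨Z, hZ, hp⟩
        exact hp x (hx Z hZ)
      · intro hx Z hZ
        obtain ⟨S, hS⟩ := hA hZ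
        subst hS
        exact fun p hp => hx p ⟨_, hZ, fun y hy => hy p hp⟩)
    (by
      rintro _ ⟨S, rfl⟩ _ ⟨T, rfl⟩
      refine ⟨{r | ∃ p ∈ S, ∃ q ∈ T, r = p * q}, ?_⟩
      ext x
      constructor
      · rintro (h | h) _ ⟨p, hp, q, hq, rfl⟩
        · rw [map_mul, h p hp, zero_mul]
        · rw [map_mul, h q hq, mul_zero]
      · intro h
        by_contra hc
        simp only [Set.mem_union, Set.mem_ofPred_eq, not_or, not_forall] at hc
        obtain ⟨⟨p, hp, hp'⟩, q, hq, hq'⟩ := hc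
        have := h (p * q) ⟨p, hp, q, hq, rfl⟩
        rw [map_mul] at this
        exact mul_ne_zero hp' hq' this)

namespace TwoNilp

variable {K : Type*} [Field K] {n : ℕ}

/-- The Zariski topology of `2Nilp_n`, as a subset of the space of structure constants. -/
abbrev zariski (K : Type*) [Field K] (n : ℕ) : TopologicalSpace (TwoNilp K n) :=
  TopologicalSpace.induced (fun μ => strConst μ.1) (zariskiAffine (StrIndex n) K)

/-- The classical (metric) topology of `2Nilp_n`, as a subset of the space of structure
constants with the product topology. -/
abbrev classical (K : Type*) [Field K] [TopologicalSpace K] (n : ℕ) :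
    TopologicalSpace (TwoNilp K n) :=
  TopologicalSpace.induced (fun μ => strConst μ.1) Pi.topologicalSpace

/-- The orbit of `μ` under `GL(K^n)`: all brackets `(x, y) ↦ g (μ (g⁻¹ x, g⁻¹ y))`. -/
def orbit (μ : TwoNilp K n) : Set (TwoNilp K n) :=
  {ν | ∃ g : Vec K n ≃ₗ[K] Vec K n, ∀ x y, ν.1 x y = g (μ.1 (g.symm x) (g.symm y))}

end TwoNilp

/-- The 2-form `α_i ∧ α_j` on `K^8`, where `α_1, …, α_8` is the dual of the standard basis
`X_1, …, X_8`. The labels `1, …, 8` correspond to `0, …, 7` in `Fin 8`. -/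
def wedge {K : Type*} [Field K] (i j : Fin 8) (x y : Vec K 8) : K :=
  x i * y j - x j * y i

/-- `dα_3 = α_1 ∧ α_2 + α_4 ∧ α_6 + α_7 ∧ α_8`. -/
def dAlpha3 {K : Type*} [Field K] (x y : Vec K 8) : K :=
  wedge 0 1 x y + wedge 3 5 x y + wedge 6 7 x y

/-- `dα_5 = α_1 ∧ α_4 + α_2 ∧ α_8 + α_6 ∧ α_7`. -/
def dAlpha5 {K : Type*} [Field K] (x y : Vec K 8) : K :=
  wedge 0 3 x y + wedge 1 7 x y + wedge 5 6 x y

/-- The bracket with Maurer-Cartan equations `dα_3`, `dα_5` as above and `dα_i = 0` for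
`i ≠ 3, 5`. Since `dα(X, Y) = -α([X, Y])`, it is `[x, y] = -dα_3(x, y) X_3 - dα_5(x, y) X_5`. -/
def k8Bracket (K : Type*) [Field K] : BilinProduct K 8 :=
  LinearMap.mk₂ K
    (fun x y => -(dAlpha3 x y) • Pi.single (2 : Fin 8) (1 : K)
      - dAlpha5 x y • Pi.single (4 : Fin 8) (1 : K))
    (by intro x x' y; simp only [dAlpha3, dAlpha5, wedge, Pi.add_apply]; module)
    (by intro c x y; simp only [dAlpha3, dAlpha5, wedge, Pi.smul_apply, smul_eq_mul]; module)
    (by intro x y y'; simp only [dAlpha3, dAlpha5, wedge, Pi.add_apply]; module)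
    (by intro c x y; simp only [dAlpha3, dAlpha5, wedge, Pi.smul_apply, smul_eq_mul]; module)

theorem k8Bracket_apply {K : Type*} [Field K] (x y : Vec K 8) :
    k8Bracket K x y = -(dAlpha3 x y) • Pi.single (2 : Fin 8) (1 : K)
      - dAlpha5 x y • Pi.single (4 : Fin 8) (1 : K) := rfl

theorem k8Bracket_two_step {K : Type*} [Field K] (x y z : Vec K 8) :
    k8Bracket K x (k8Bracket K y z) = 0 := by
  simp [k8Bracket_apply, dAlpha3, dAlpha5, wedge]

theorem k8Bracket_two_step' {K : Type*} [Field K] (x y z : Vec K 8) :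
    k8Bracket K (k8Bracket K x y) z = 0 := by
  simp [k8Bracket_apply, dAlpha3, dAlpha5, wedge]

theorem k8Bracket_isLieBracket (K : Type*) [Field K] : IsLieBracket (k8Bracket K) where
  alt x := by simp [k8Bracket_apply, dAlpha3, dAlpha5, wedge, mul_comm]
  jacobi x y z := by simp [k8Bracket_two_step']

/-- The Lie algebra `𝔨_8` as a point of `2Nilp_8`. -/
def k8 (K : Type*) [Field K] : TwoNilp K 8 :=
  ⟨k8Bracket K, k8Bracket_isLieBracket K, k8Bracket_two_step⟩

end

/-! Near `𝔨_8` a bracket is governed by two alternating forms `A`, `B` on `K^6`: its third and fifth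
components on the span of the other six basis vectors. If `A` is nondegenerate, `B` is up to a
scalar `A (·, T ·)` with `T` self-adjoint, and generically `T` satisfies a cubic
(`exists_cubic_relation`). A binary cubic whose Hessian splits into distinct linear factors is a
combination of the cubes of those factors (`sum_cubes_identity`). Taking the factors as new basis of
the pencil replaces `T` by `S` with `S ^ 3 = -1`, and then both forms take the shape of `dα_3` and
`dα_5` (`exists_hexagon`).

The other components carry no further information: brackets are central, and nondegeneracy of `A`
makes a central vector determined by its third and fifth coordinates
(`TwoNilp.mem_orbit_k8_of_frame`).

The argument thus needs one polynomial in the structure constants to be nonzero and the Hessian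
discriminant to be a nonzero square: over `ℂ` non-vanishing suffices, over `ℝ` positivity. These
open conditions hold at `𝔨_8`, and the group action carries the resulting neighbourhood along the
orbit. -/

open Polynomial in
theorem sum_cubes_identity {K : Type*} [Field K] [CharZero K] {q r k : K}
    (hk : k ^ 2 = 9 * r * k + 3 * q ^ 3) :
    C k * (C (3 * q) * X + C k) ^ 3 + C 9 * (C k * X - C (q ^ 2)) ^ 3 =
      C (9 * k * (k ^ 2 + 3 * q ^ 3)) * (X ^ 3 + C q * X + C r) := by
  have h : (C k : K[X]) ^ 2 = 9 * C r * C k + 3 * C q ^ 3 := by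
    have := congrArg (C : K → K[X]) hk
    simpa only [map_mul, map_add, map_pow, map_ofNat] using this
  simp only [map_mul, map_add, map_pow, map_ofNat]
  linear_combination ((C k ^ 2 + 3 * C q ^ 3) : K[X]) * h

/-! ### Self-adjoint operators for a symplectic form and their Krylov spaces -/

section SelfAdjoint

variable {K V : Type*} [Field K] [AddCommGroup V] [Module K V]
  {A : LinearMap.BilinForm K V} {T : Module.End K V}

theorem pow_selfAdjoint (hT : ∀ x y, A (T x) y = A x (T y)) (n : ℕ) (x y : V) :
    A ((T ^ n) x) y = A x ((T ^ n) y) := by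
  induction n generalizing x y with
  | zero => simp
  | succ n ih => rw [pow_succ, Module.End.mul_apply, ih, hT, ← Module.End.mul_apply, ← pow_succ',
      pow_succ]

/-- Powers of `T` can be moved across `A`, so the value is both `A x (T ^ (i + j) x)` and `A (T ^ (i
+ j) x) x`, which are opposite. -/
theorem krylov_isotropic [CharZero K] (hA : A.IsAlt) (hT : ∀ x y, A (T x) y = A x (T y))
    (i j : ℕ) (x : V) : A ((T ^ i) x) ((T ^ j) x) = 0 := by
  have h1 := pow_selfAdjoint hT i x ((T ^ j) x)
  have h2 := pow_selfAdjoint hT j x ((T ^ i) x)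
  rw [← Module.End.mul_apply, ← pow_add] at h1 h2
  have h3 := LinearMap.IsAlt.neg hA ((T ^ i) x) ((T ^ j) x)
  rw [add_comm] at h2
  have h4 : 2 * A ((T ^ i) x) ((T ^ j) x) = 0 := by
    rw [h2, ← h1] at h3
    linear_combination -h3
  simpa using h4

theorem exists_krylov_dual [FiniteDimensional K V] (hA : A.IsAlt) (hnd : A.Nondegenerate) {u : V}
    (hu : LinearIndependent K ![u, T u, (T ^ 2) u]) :
    ∃ w, A u w = 0 ∧ A (T u) w = 0 ∧ A ((T ^ 2) u) w = 1 := by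
  obtain ⟨f, hf⟩ : ∃ f : V →ₗ[K] K, ∀ i, f (![u, T u, (T ^ 2) u] i) = ![0, 0, 1] i := by
    obtain ⟨f, hf⟩ := LinearMap.exists_extend
      ((Module.Basis.span hu).constr K (![0, 0, 1] : Fin 3 → K))
    refine ⟨f, fun i => ?_⟩
    have := LinearMap.congr_fun hf (Module.Basis.span hu i)
    rw [Module.Basis.constr_basis] at this
    rw [← this, LinearMap.comp_apply, Submodule.subtype_apply, Module.Basis.span_apply]
  have h (x : V) : A x (-(A.toDual hnd).symm f) = f x := by
    rw [map_neg, LinearMap.IsAlt.neg hA, LinearMap.BilinForm.apply_toDual_symm_apply]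
  refine ⟨-(A.toDual hnd).symm f, ?_⟩
  simp only [h]
  exact ⟨hf 0, hf 1, hf 2⟩

theorem krylov_pair_gram (hT : ∀ x y, A (T x) y = A x (T y)) (u w : V) (i j : ℕ) :
    A ((T ^ i) u) ((T ^ j) w) = A u ((T ^ (i + j)) w) := by
  rw [pow_selfAdjoint hT, ← Module.End.mul_apply, ← pow_add]

/-- Pairing with `u, T u, T ^ 2 u` kills the `u`-part by isotropy and leaves a triangular Hankel
system in `g 3, g 4, g 5` with units on the antidiagonal. -/
theorem krylov_pair_eq_zero [CharZero K] (hA : A.IsAlt) (hT : ∀ x y, A (T x) y = A x (T y))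
    {u w : V} (h0 : A u w = 0) (h1 : A (T u) w = 0) (h2 : A ((T ^ 2) u) w = 1)
    (g : Fin 6 → K)
    (hg : ∀ j : ℕ, A (g 0 • u + g 1 • T u + g 2 • (T ^ 2) u + g 3 • w + g 4 • T w
      + g 5 • (T ^ 2) w) ((T ^ j) u) = 0) : g 3 = 0 ∧ g 4 = 0 ∧ g 5 = 0 := by
  have iso (i j : ℕ) := krylov_isotropic hA hT i j u
  have gram (i j : ℕ) : A ((T ^ i) w) ((T ^ j) u) = - A ((T ^ (i + j)) u) w := by
    rw [← LinearMap.IsAlt.neg hA, krylov_pair_gram hT, pow_selfAdjoint hT, add_comm]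
  have key (j : ℕ) : g 3 * A ((T ^ j) u) w + g 4 * A ((T ^ (1 + j)) u) w
      + g 5 * A ((T ^ (2 + j)) u) w = 0 := by
    have h := hg j
    have i0 := iso 0 j
    have i1 := iso 1 j
    have g0 := gram 0 j
    have g1 := gram 1 j
    simp only [pow_zero, pow_one, Module.End.one_apply, zero_add] at i0 i1 g0 g1
    simp only [map_add, map_smul, LinearMap.add_apply, LinearMap.smul_apply, smul_eq_mul,
      i0, i1, iso 2 j, g0, g1, gram 2 j] at h
    linear_combination -h
  have k0 := key 0
  have k1 := key 1
  have k2 := key 2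
  norm_num [h0, h1, h2] at k0 k1 k2
  rw [k0] at k1 k2
  norm_num at k1 k2
  rw [k1] at k2
  norm_num at k2
  exact ⟨k2, k1, k0⟩

theorem krylov_pair_linearIndependent [CharZero K] (hA : A.IsAlt)
    (hT : ∀ x y, A (T x) y = A x (T y)) {u w : V}
    (hu : LinearIndependent K ![u, T u, (T ^ 2) u])
    (h0 : A u w = 0) (h1 : A (T u) w = 0) (h2 : A ((T ^ 2) u) w = 1) :
    LinearIndependent K ![u, T u, (T ^ 2) u, w, T w, (T ^ 2) w] := by
  rw [Fintype.linearIndependent_iff]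
  intro g hg
  simp only [Fin.sum_univ_six] at hg
  obtain ⟨g3, g4, g5⟩ := krylov_pair_eq_zero hA hT h0 h1 h2 g fun j => by
    have : g 0 • u + g 1 • T u + g 2 • (T ^ 2) u + g 3 • w + g 4 • T w + g 5 • (T ^ 2) w = 0 := hg
    rw [this, map_zero, LinearMap.zero_apply]
  have hu' := Fintype.linearIndependent_iff.1 hu ![g 0, g 1, g 2] (by
    rw [Fin.sum_univ_three]
    have : g 0 • u + g 1 • T u + g 2 • (T ^ 2) u + g 3 • w + g 4 • T w + g 5 • (T ^ 2) w = 0 := hg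
    simpa [g3, g4, g5] using this)
  intro i
  fin_cases i
  exacts [hu' 0, hu' 1, hu' 2, g3, g4, g5]

/-- A self-adjoint operator for a symplectic form in dimension six that has a cyclic vector of
order three is annihilated by a cubic polynomial. -/
theorem exists_cubic_relation [CharZero K] [FiniteDimensional K V]
    (hV : Module.finrank K V = 6) (hA : A.IsAlt) (hnd : A.Nondegenerate)
    (hT : ∀ x y, A (T x) y = A x (T y)) {u : V}
    (hu : LinearIndependent K ![u, T u, (T ^ 2) u]) :
    ∃ a b c : K, T ^ 3 = a • T ^ 2 + b • T + c • 1 := by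
  obtain ⟨w, h0, h1, h2⟩ := exists_krylov_dual hA hnd hu
  let e := basisOfLinearIndependentOfCardEqFinrank
    (krylov_pair_linearIndependent hA hT hu h0 h1 h2) (by simp [hV])
  have he : ⇑e = ![u, T u, (T ^ 2) u, w, T w, (T ^ 2) w] := by
    simp [e]
  have hsum (x : V) : ∃ g : Fin 6 → K, x = g 0 • u + g 1 • T u + g 2 • (T ^ 2) u + g 3 • w
      + g 4 • T w + g 5 • (T ^ 2) w := by
    refine ⟨e.repr x, ?_⟩
    have := (e.sum_repr x).symm
    rw [he, Fin.sum_univ_six] at this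
    exact this
  -- The Krylov space of `u` is Lagrangian and `T ^ 3 u` is orthogonal to it, hence lies in it; this
  -- gives the cubic.
  obtain ⟨g, hg⟩ := hsum ((T ^ 3) u)
  obtain ⟨g3, g4, g5⟩ := krylov_pair_eq_zero hA hT h0 h1 h2 g fun j => by
    rw [← hg, krylov_isotropic hA hT]
  refine ⟨g 2, g 1, g 0, ?_⟩
  set P : Module.End K V := T ^ 3 - (g 2 • T ^ 2 + g 1 • T + g 0 • 1) with hP
  have hPu : P u = 0 := by
    simp only [hP, LinearMap.sub_apply, hg, g3, g4, g5, LinearMap.add_apply,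
      LinearMap.smul_apply, Module.End.one_apply]
    module
  have hcomm (j : ℕ) : Commute P (T ^ j) := by
    refine Commute.pow_right ?_ j
    simp only [hP]
    refine .sub_left (.pow_left (.refl T) 3) (.add_left (.add_left ?_ ?_) ?_)
    · exact .smul_left (.pow_left (.refl T) 2) _
    · exact .smul_left (.refl T) _
    · exact .smul_left (.one_left _) _
  have hPT (j : ℕ) (x : V) : P ((T ^ j) x) = (T ^ j) (P x) := by
    rw [← Module.End.mul_apply, (hcomm j).eq, Module.End.mul_apply]
  have hadj (x y : V) : A (P x) y = A x (P y) := by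
    have p2 := pow_selfAdjoint hT 2 x y
    have p3 := pow_selfAdjoint hT 3 x y
    simp only [hP, LinearMap.sub_apply, LinearMap.add_apply, LinearMap.smul_apply,
      Module.End.one_apply, map_sub, map_add, map_smul, p2, p3, hT]
  -- `P w` is orthogonal to the powers on `u` because `P` moves across to `P u = 0`, and to the
  -- powers on `w` by isotropy.
  have hPw : P w = 0 := by
    refine hnd.1 _ fun x => ?_
    obtain ⟨s, rfl⟩ := hsum x
    have hu0 (j : ℕ) : A (P w) ((T ^ j) u) = 0 := by
      rw [hadj, hPT, hPu, map_zero, map_zero]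
    have hw0 (j : ℕ) : A (P w) ((T ^ j) w) = 0 := by
      have i0 := krylov_isotropic hA hT 0 j w
      have i1 := krylov_isotropic hA hT 1 j w
      simp only [pow_zero, pow_one, Module.End.one_apply] at i0 i1
      simp only [hP, LinearMap.sub_apply, LinearMap.add_apply, LinearMap.smul_apply,
        Module.End.one_apply, map_sub, map_add, map_smul, i0, i1, krylov_isotropic hA hT]
      simp
    have a0 := hu0 0
    have a1 := hu0 1
    have b0 := hw0 0
    have b1 := hw0 1
    simp only [pow_zero, pow_one, Module.End.one_apply] at a0 a1 b0 b1
    simp [a0, a1, b0, b1, hu0 2, hw0 2]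
  have hP0 : P = 0 := by
    ext x
    obtain ⟨s, rfl⟩ := hsum x
    have a1 := hPT 1 u
    have b1 := hPT 1 w
    simp only [pow_one] at a1 b1
    simp [a1, b1, hPT 2, hPu, hPw]
  exact sub_eq_zero.1 hP0

/-- If a self-adjoint operator `S` with `S ^ 3 = -1` has a cyclic vector of order three, then
the forms `A` and `A (·, S ·)` are simultaneously brought to the normal form of `𝔨_8`. -/
theorem exists_hexagon_of_cube_eq_neg_one [CharZero K] [FiniteDimensional K V]
    (hA : A.IsAlt) (hnd : A.Nondegenerate)
    (hT : ∀ x y, A (T x) y = A x (T y)) (hT3 : T ^ 3 = -1) {u : V}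
    (hu : LinearIndependent K ![u, T u, (T ^ 2) u]) :
    ∃ b : (Fin 6 → K) →ₗ[K] V, ∀ x y,
      A (b x) (b y) = (x 0 * y 1 - x 1 * y 0) + (x 2 * y 3 - x 3 * y 2)
        + (x 4 * y 5 - x 5 * y 4) ∧
      A (b x) (T (b y)) = (x 0 * y 2 - x 2 * y 0) + (x 1 * y 5 - x 5 * y 1)
        + (x 3 * y 4 - x 4 * y 3) := by
  obtain ⟨w, h0, h1, h2⟩ := exists_krylov_dual hA hnd hu
  have isoU (i j : ℕ) := krylov_isotropic hA hT i j u
  have isoW (i j : ℕ) := krylov_isotropic hA hT i j w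
  have f0 : A u ((T ^ 0) w) = 0 := by simpa using h0
  have f1 : A u ((T ^ 1) w) = 0 := by rw [pow_one, ← hT, h1]
  have f2 : A u ((T ^ 2) w) = 1 := by rw [← pow_selfAdjoint hT, h2]
  have fs (n : ℕ) : A u ((T ^ (n + 3)) w) = - A u ((T ^ n) w) := by
    rw [pow_add, hT3]; simp
  have f3 := fs 0
  have f4 := fs 1
  have f5 := fs 2
  rw [f0] at f3
  rw [f1] at f4
  rw [f2] at f5
  have gUW (i j : ℕ) := krylov_pair_gram hT u w i j
  have gWU (i j : ℕ) : A ((T ^ i) w) ((T ^ j) u) = - A u ((T ^ (i + j)) w) := by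
    rw [← LinearMap.IsAlt.neg hA, gUW, add_comm]
  have hs (i : ℕ) (x : V) : T ((T ^ i) x) = (T ^ (i + 1)) x := by
    rw [pow_succ', Module.End.mul_apply]
  -- `A u (T ^ n w)` is nonzero only for `n ≡ 2` mod 3. The edges of the two target forms make up
  -- the hexagon 0-1-5-4-3-2; vectors from `u` and from `w` alternate around it, with exponents
  -- adding to 2 mod 3 along each edge once the `T` of the second form is counted.
  refine ⟨Fintype.linearCombination K ![(T ^ 0) u, (T ^ 2) w, (T ^ 1) w, -(T ^ 1) u,
    -(T ^ 0) w, (T ^ 2) u], fun x y => ?_⟩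
  simp only [Fintype.linearCombination_apply, Fin.sum_univ_six]
  simp only [Matrix.cons_val, map_add, map_smul, map_neg, LinearMap.add_apply,
    LinearMap.smul_apply, LinearMap.neg_apply, smul_eq_mul, hs, isoU, isoW, gUW, gWU]
  norm_num only [f0, f1, f2, f3, f4, f5]
  constructor <;> ring

end SelfAdjoint

/-! ### Diagonalising the cubic of a pencil as a sum of two cubes -/

section NormalForm

variable {K V : Type*} [Field K] [AddCommGroup V] [Module K V]
  {A : LinearMap.BilinForm K V} {R : Module.End K V}

open Polynomial in
theorem sum_cubes_operator [CharZero K] {q r k : K} (hk : k ^ 2 = 9 * r * k + 3 * q ^ 3)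
    (hR : R ^ 3 + q • R + r • 1 = 0) :
    k • ((3 * q) • R + k • 1) ^ 3 + (9 : K) • (k • R - (q ^ 2) • 1) ^ 3 = 0 := by
  have h := congrArg (aeval R) (sum_cubes_identity hk)
  simp only [map_mul, map_add, map_sub, map_pow, aeval_C, aeval_X, Algebra.algebraMap_eq_smul_one]
    at h
  simpa only [smul_mul_assoc, one_mul, hR, mul_zero, smul_zero, _root_.smul_pow, one_pow, mul_smul]
    using h

/-- The equations are the coefficients of `x0 N² + x1 M N + x2 M²`, where `M = 3qX + k` and `N = kX
- q²`. Evaluation at the root of `N` isolates `x2`; the derivative there then isolates `x1`. -/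
theorem independent_quadratics [CharZero K] {q k : K} (hk : k ≠ 0) (hd : k ^ 2 + 3 * q ^ 3 ≠ 0)
    {x0 x1 x2 : K} (e0 : x0 * q ^ 4 - x1 * (k * q ^ 2) + x2 * k ^ 2 = 0)
    (e1 : -(2 * k * q ^ 2) * x0 + (k ^ 2 - 3 * q ^ 3) * x1 + 6 * q * k * x2 = 0)
    (e2 : k ^ 2 * x0 + 3 * q * k * x1 + 9 * q ^ 2 * x2 = 0) : x0 = 0 ∧ x1 = 0 ∧ x2 = 0 := by
  have h2 : (k ^ 2 + 3 * q ^ 3) ^ 2 * x2 = 0 := by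
    linear_combination q ^ 4 * e2 + k * q ^ 2 * e1 + k ^ 2 * e0
  have h2 : x2 = 0 := by simpa [hd] using h2
  subst h2
  have h1 : (k ^ 2 + 3 * q ^ 3) * k * x1 = 0 := by
    linear_combination k * e1 + 2 * q ^ 2 * e2
  have h1 : x1 = 0 := by simpa [hd, hk] using h1
  subst h1
  have h0 : k ^ 2 * x0 = 0 := by linear_combination e2
  exact ⟨by simpa [hk] using h0, rfl, rfl⟩

/-- Simultaneous normal form of the pencil spanned by `A` and `A (·, R ·)`, when the
minimal polynomial of `R` is a depressed cubic whose Hessian splits. -/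
theorem exists_hexagon [CharZero K] (hcube : ∀ x : K, ∃ y, y ^ 3 = x)
    [FiniteDimensional K V] (hA : A.IsAlt) (hnd : A.Nondegenerate)
    (hT : ∀ x y, A (R x) y = A x (R y)) {q r s : K} (hR : R ^ 3 + q • R + r • 1 = 0)
    (hr : r ≠ 0) (hs : 81 * r ^ 2 + 12 * q ^ 3 = s ^ 2) (hs0 : s ≠ 0) {u : V}
    (hu : LinearIndependent K ![u, R u, (R ^ 2) u]) :
    ∃ α β γ δ : K, α * δ - β * γ ≠ 0 ∧ ∃ b : (Fin 6 → K) →ₗ[K] V, ∀ x y,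
      γ * A (b x) (R (b y)) + δ * A (b x) (b y) =
        (x 0 * y 1 - x 1 * y 0) + (x 2 * y 3 - x 3 * y 2) + (x 4 * y 5 - x 5 * y 4) ∧
      α * A (b x) (R (b y)) + β * A (b x) (b y) =
        (x 0 * y 2 - x 2 * y 0) + (x 1 * y 5 - x 5 * y 1) + (x 3 * y 4 - x 4 * y 3) := by
  -- The roots of `k² - 9rk - 3q³` are `(9r ± s) / 2`. Their sum `9r` is nonzero, so one of them is
  -- nonzero; for it `k² + 3q³` equals `k` times `±s`.
  obtain ⟨k, hk, hk0, hd⟩ : ∃ k : K, k ^ 2 = 9 * r * k + 3 * q ^ 3 ∧ k ≠ 0 ∧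
      k ^ 2 + 3 * q ^ 3 ≠ 0 := by
    have main (s : K) (hs : 81 * r ^ 2 + 12 * q ^ 3 = s ^ 2) (hs0 : s ≠ 0)
        (hk0 : (9 * r + s) / 2 ≠ 0) : ∃ k : K, k ^ 2 = 9 * r * k + 3 * q ^ 3 ∧ k ≠ 0 ∧
        k ^ 2 + 3 * q ^ 3 ≠ 0 := by
      refine ⟨(9 * r + s) / 2, by linear_combination -hs / 4, hk0, ?_⟩
      have : ((9 * r + s) / 2) ^ 2 + 3 * q ^ 3 = ((9 * r + s) / 2) * s := by
        linear_combination hs / 4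
      rw [this]
      exact mul_ne_zero hk0 hs0
    by_cases h : (9 * r + s) / 2 = 0
    · refine main (-s) (by rw [hs]; ring) (neg_ne_zero.2 hs0) fun h' => hr ?_
      linear_combination (h + h') / 9
    · exact main s hs hs0 h
  have hsum := sum_cubes_operator hk hR
  set M : Module.End K V := (3 * q) • R + k • 1 with hM
  set N : Module.End K V := k • R - (q ^ 2) • 1 with hN
  have hMN : M * N = N * M := by
    simp only [hM, hN]
    simp only [add_mul, mul_add, sub_mul, mul_sub, smul_mul_assoc, mul_smul_comm, mul_one, one_mul]
    module
  have hone : (1 : Module.End K V) = (k ^ 2 + 3 * q ^ 3)⁻¹ • (k • M - (3 * q) • N) := by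
    have : k • M - (3 * q) • N = (k ^ 2 + 3 * q ^ 3) • (1 : Module.End K V) := by
      simp only [hM, hN]; module
    rw [this, smul_smul, inv_mul_cancel₀ hd, one_smul]
  -- On the kernel of `N` the relation gives `M ^ 3 = 0`, while `1` is a combination of `M` and `N`;
  -- so `M` can be cancelled there three times.
  have hNinj : Function.Injective N := by
    rw [injective_iff_map_eq_zero]
    intro x hx
    have h1 : M ((M ^ 2) x) = 0 := by
      have := LinearMap.congr_fun hsum x
      simp only [LinearMap.add_apply, LinearMap.smul_apply, LinearMap.zero_apply] at this
      rw [pow_succ N, Module.End.mul_apply, hx, map_zero, smul_zero, add_zero, smul_eq_zero,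
        pow_succ', Module.End.mul_apply] at this
      exact this.resolve_left hk0
    have hNM (x) (h : N x = 0) : N (M x) = 0 := by
      rw [← Module.End.mul_apply, ← hMN, Module.End.mul_apply, h, map_zero]
    have step (x) (h : N x = 0) (h' : M x = 0) : x = 0 := by
      have := LinearMap.congr_fun hone x
      simpa [h, h'] using this
    have h2 : N ((M ^ 2) x) = 0 := by
      rw [pow_two, Module.End.mul_apply]
      exact hNM _ (hNM _ hx)
    have h3 := step _ h2 h1
    rw [pow_two, Module.End.mul_apply] at h3
    exact step _ hx (step _ (hNM _ hx) h3)
  obtain ⟨N', hN'⟩ : ∃ N' : Module.End K V, N * N' = 1 := by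
    refine ⟨(LinearEquiv.ofInjectiveEndo N hNinj).symm, ?_⟩
    ext x
    simp
  -- Since `k M³ = -9 N³`, this scaling makes the cube of `ρ M / N` equal to `-1`.
  obtain ⟨ρ, hρ⟩ := hcube (k / 9)
  have hρ0 : ρ ≠ 0 := by
    rintro rfl
    have : k / 9 = 0 := by rw [← hρ]; ring
    exact hk0 (by linear_combination 9 * this)
  have hcancel {X Y : Module.End K V} (h : N * X = N * Y) : X = Y := by
    ext x
    exact hNinj (LinearMap.congr_fun h x)
  set S : Module.End K V := ρ • (N' * M) with hS
  have hNS : N * S = ρ • M := by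
    rw [hS, mul_smul_comm, ← mul_assoc, hN', one_mul]
  have hSN : S * N = ρ • M := hcancel (by
    rw [← mul_assoc, hNS, smul_mul_assoc, hMN, mul_smul_comm])
  have hcommSN : Commute S N := by rw [Commute, SemiconjBy, hNS, hSN]
  have hS2 : N ^ 2 * S ^ 2 = ρ ^ 2 • M ^ 2 := by
    rw [← hcommSN.symm.mul_pow, hNS, smul_pow]
  have hS3 : S ^ 3 = -1 := by
    have h3 : N ^ 3 * S ^ 3 = ρ ^ 3 • M ^ 3 := by
      rw [← hcommSN.symm.mul_pow, hNS, smul_pow]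
    have h4 : N ^ 3 * S ^ 3 = N ^ 3 * (-1) := by
      rw [h3, hρ, mul_neg, mul_one, eq_neg_iff_add_eq_zero]
      have := congrArg (fun X => (9 : K)⁻¹ • X) hsum
      simp only [smul_add, smul_smul, smul_zero] at this
      rw [inv_mul_cancel₀ (by norm_num), one_smul] at this
      rw [div_eq_inv_mul]
      exact this
    rw [pow_succ', pow_succ', pow_one, mul_assoc, mul_assoc, mul_assoc, mul_assoc] at h4
    exact hcancel (hcancel (hcancel h4))
  let A' : LinearMap.BilinForm K V := A.compl₂ N
  have hA' (x y : V) : A' x y = A x (N y) := rfl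
  have hMadj (x y : V) : A (M x) y = A x (M y) := by
    simp [hM, hT]
  have hNadj (x y : V) : A (N x) y = A x (N y) := by
    simp [hN, hT]
  have hNS' (x : V) : N (S x) = ρ • M x := by
    rw [← Module.End.mul_apply, hNS, LinearMap.smul_apply]
  have halt : A'.IsAlt := by
    intro x
    have h := krylov_isotropic hA hT 0 1 x
    have h' := hA x
    simp only [pow_zero, pow_one, Module.End.one_apply] at h
    simp [hA', hN, h, h']
  have hnd' : A'.Nondegenerate := by
    refine ⟨fun x hx => hnd.1 x fun y => ?_, fun x hx => hNinj ?_⟩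
    · have := hx (N' y)
      rwa [hA', ← Module.End.mul_apply, hN', Module.End.one_apply] at this
    · rw [map_zero]
      exact hnd.2 _ hx
  have hadj (x y : V) : A' (S x) y = A' x (S y) := by
    rw [hA', hA', ← hNadj, hNS', hNS', map_smul, LinearMap.smul_apply, map_smul, hMadj]
  have hind : LinearIndependent K ![u, S u, (S ^ 2) u] := by
    rw [Fintype.linearIndependent_iff] at hu ⊢
    intro g hg
    rw [Fin.sum_univ_three] at hg
    have hg : g 0 • u + g 1 • S u + g 2 • (S ^ 2) u = 0 := hg
    -- Applying `N ^ 2` clears the inverse and leaves quadratics in `R`.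
    have hg := congrArg (fun x => (N ^ 2) x) hg
    simp only [map_add, map_smul, map_zero] at hg
    rw [← Module.End.mul_apply (N ^ 2) (S ^ 2), hS2, pow_two, Module.End.mul_apply N N (S u),
      hNS', pow_two M] at hg
    have hRR : (R ^ 2) u = R (R u) := by rw [pow_two, Module.End.mul_apply]
    have hz := hu ![g 0 * q ^ 4 - (g 1 * ρ) * (k * q ^ 2) + (g 2 * ρ ^ 2) * k ^ 2,
      -(2 * k * q ^ 2) * g 0 + (k ^ 2 - 3 * q ^ 3) * (g 1 * ρ) + 6 * q * k * (g 2 * ρ ^ 2),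
      k ^ 2 * g 0 + 3 * q * k * (g 1 * ρ) + 9 * q ^ 2 * (g 2 * ρ ^ 2)] (by
        rw [Fin.sum_univ_three, ← hg]
        simp only [Matrix.cons_val, hM, hN, hRR, Module.End.mul_apply,
          LinearMap.add_apply, LinearMap.sub_apply,
          LinearMap.smul_apply, Module.End.one_apply, map_add, map_sub, map_smul]
        module)
    obtain ⟨e0, e1, e2⟩ := independent_quadratics hk0 hd (hz 0) (hz 1) (hz 2)
    have e1 : g 1 = 0 := by simpa [hρ0] using e1
    have e2 : g 2 = 0 := by simpa [hρ0] using e2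
    intro i
    fin_cases i
    exacts [e0, e1, e2]
  obtain ⟨b, hb⟩ := exists_hexagon_of_cube_eq_neg_one halt hnd' hadj hS3 hind
  refine ⟨ρ * (3 * q), ρ * k, k, -q ^ 2, ?_, b, fun x y => ⟨?_, ?_⟩⟩
  · have : ρ * (3 * q) * -q ^ 2 - ρ * k * k = -(ρ * (k ^ 2 + 3 * q ^ 3)) := by ring
    rw [this]
    exact neg_ne_zero.2 (mul_ne_zero hρ0 hd)
  · rw [← (hb x y).1, hA']
    simp [hN]; ring
  · rw [← (hb x y).2, hA', hNS']
    simp [hM]; ring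

end NormalForm

/-! ### From a frame to an isomorphism with `𝔨_8` -/

section Frame

variable {K : Type*} [Field K]

/-- The positions of the basis vectors of `𝔨_8` outside the derived algebra. -/
def symIdx : Fin 6 → Fin 8 := ![0, 1, 3, 5, 6, 7]

theorem TwoNilp.apply_swap {n : ℕ} (ν : TwoNilp K n) (x y : Vec K n) : ν.1 x y = -ν.1 y x := by
  have h := ν.2.1.alt (x + y)
  simp only [map_add, LinearMap.add_apply, ν.2.1.alt, zero_add, add_zero] at h
  exact eq_neg_of_add_eq_zero_right h

theorem TwoNilp.apply_apply_left {n : ℕ} (ν : TwoNilp K n) (x y z : Vec K n) :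
    ν.1 (ν.1 x y) z = 0 := by
  rw [ν.apply_swap, ν.2.2, neg_zero]

theorem k8Bracket_eq (x y : Vec K 8) (x' y' : Fin 6 → K) (hx : x' = x ∘ symIdx)
    (hy : y' = y ∘ symIdx) :
    dAlpha3 x y = (x' 0 * y' 1 - x' 1 * y' 0) + (x' 2 * y' 3 - x' 3 * y' 2)
        + (x' 4 * y' 5 - x' 5 * y' 4) ∧
    dAlpha5 x y = (x' 0 * y' 2 - x' 2 * y' 0) + (x' 1 * y' 5 - x' 5 * y' 1)
        + (x' 3 * y' 4 - x' 4 * y' 3) := by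
  subst hx hy
  exact ⟨rfl, rfl⟩

/-- A bracket admitting six vectors on which two functionals, jointly injective on the centre,
take the values of `dα_3` and `dα_5` is isomorphic to `𝔨_8`. -/
theorem TwoNilp.mem_orbit_k8_of_frame (ν : TwoNilp K 8) (φ ψ : Vec K 8 →ₗ[K] K)
    (f : (Fin 6 → K) →ₗ[K] Vec K 8)
    (hinj : ∀ z, (∀ x, ν.1 z x = 0) → φ z = 0 → ψ z = 0 → z = 0)
    (hφ : ∀ x y, φ (ν.1 (f x) (f y)) = (x 0 * y 1 - x 1 * y 0) + (x 2 * y 3 - x 3 * y 2)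
        + (x 4 * y 5 - x 5 * y 4))
    (hψ : ∀ x y, ψ (ν.1 (f x) (f y)) = (x 0 * y 2 - x 2 * y 0) + (x 1 * y 5 - x 5 * y 1)
        + (x 3 * y 4 - x 4 * y 3)) :
    ν ∈ (k8 K).orbit := by
  -- `z` and `t` are the images of `X_3` and `X_5`; the signs come from `dα(X, Y) = -α([X, Y])`.
  obtain ⟨z, hz⟩ : ∃ z, z = -ν.1 (f (Pi.single 0 1)) (f (Pi.single 1 1)) := ⟨_, rfl⟩
  obtain ⟨t, ht⟩ : ∃ t, t = -ν.1 (f (Pi.single 0 1)) (f (Pi.single 2 1)) := ⟨_, rfl⟩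
  have hzl (x) : ν.1 z x = 0 := by
    rw [hz, map_neg, LinearMap.neg_apply, ν.apply_apply_left, neg_zero]
  have htl (x) : ν.1 t x = 0 := by
    rw [ht, map_neg, LinearMap.neg_apply, ν.apply_apply_left, neg_zero]
  have hzr (x) : ν.1 x z = 0 := by rw [ν.apply_swap, hzl, neg_zero]
  have htr (x) : ν.1 x t = 0 := by rw [ν.apply_swap, htl, neg_zero]
  have φz : φ z = -1 := by simp [hz, hφ]
  have φt : φ t = 0 := by simp [ht, hφ]
  have ψz : ψ z = 0 := by simp [hz, hψ]
  have ψt : ψ t = -1 := by simp [ht, hψ]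
  let g : Vec K 8 →ₗ[K] Vec K 8 := f ∘ₗ LinearMap.funLeft K K symIdx
    + (LinearMap.proj 2).smulRight z + (LinearMap.proj 4).smulRight t
  have hg (x : Vec K 8) : g x = f (x ∘ symIdx) + x 2 • z + x 4 • t := rfl
  have hνg (x y : Vec K 8) : ν.1 (g x) (g y) = ν.1 (f (x ∘ symIdx)) (f (y ∘ symIdx)) := by
    simp [hg, hzl, htl, hzr, htr]
  have hν (x y : Vec K 8) : ν.1 (g x) (g y) = g (k8Bracket K x y) := by
    have hk : g (k8Bracket K x y) = -(dAlpha3 x y) • z - dAlpha5 x y • t := by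
      have e1 : (Pi.single 2 1 : Vec K 8) ∘ symIdx = 0 := by
        ext i; fin_cases i <;> simp [symIdx]
      have e2 : (Pi.single 4 1 : Vec K 8) ∘ symIdx = 0 := by
        ext i; fin_cases i <;> simp [symIdx]
      rw [k8Bracket_apply, map_sub, map_smul, map_smul, hg, hg, e1, e2]
      simp
    obtain ⟨h3, h5⟩ := k8Bracket_eq x y _ _ rfl rfl
    rw [hk, ← sub_eq_zero]
    -- Both sides are central, so comparing `φ` and `ψ` is enough.
    refine hinj _ (fun w => ?_) ?_ ?_
    · simp [ν.apply_apply_left, hzl, htl]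
    · simp only [map_sub, map_smul, hνg, hφ, φz, φt, h3, smul_eq_mul]; ring
    · simp only [map_sub, map_smul, hνg, hψ, ψz, ψt, h5, smul_eq_mul]; ring
  have hginj : Function.Injective g := by
    rw [injective_iff_map_eq_zero]
    intro x hx
    have key (y : Fin 6 → K) : φ (ν.1 (f (x ∘ symIdx)) (f y)) = 0 := by
      have : ν.1 (g x) (f y) = 0 := by rw [hx, map_zero, LinearMap.zero_apply]
      rw [hg] at this
      simp only [map_add, map_smul, LinearMap.add_apply, LinearMap.smul_apply, hzl, htl,
        smul_zero, add_zero] at this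
      rw [this, map_zero]
    have hp : x ∘ symIdx = 0 := by
      have k0 := key (Pi.single 0 1)
      have k1 := key (Pi.single 1 1)
      have k2 := key (Pi.single 2 1)
      have k3 := key (Pi.single 3 1)
      have k4 := key (Pi.single 4 1)
      have k5 := key (Pi.single 5 1)
      simp only [hφ] at k0 k1 k2 k3 k4 k5
      simp at k0 k1 k2 k3 k4 k5
      ext i
      fin_cases i
      exacts [k1, k0, k3, k2, k5, k4]
    rw [hg, hp, map_zero, zero_add] at hx
    have h2 : x 2 = 0 := by
      have := congrArg φ hx
      simpa [φz, φt] using this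
    have h4 : x 4 = 0 := by
      have := congrArg ψ hx
      simpa [ψz, ψt] using this
    ext i
    fin_cases i
    exacts [congrFun hp 0, congrFun hp 1, h2, congrFun hp 2, h4, congrFun hp 3, congrFun hp 4,
      congrFun hp 5]
  refine ⟨LinearEquiv.ofInjectiveEndo g hginj, fun x y => ?_⟩
  have h := hν ((LinearEquiv.ofInjectiveEndo g hginj).symm x)
    ((LinearEquiv.ofInjectiveEndo g hginj).symm y)
  have hs (w) : g ((LinearEquiv.ofInjectiveEndo g hginj).symm w) = w :=
    (LinearEquiv.ofInjectiveEndo g hginj).apply_symm_apply w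
  rw [hs, hs] at h
  exact h

end Frame

/-! ### Division-free invariants of the pencil -/

section Invariants

variable {R : Type*} [CommRing R]

/-- The matrix of the `k`-th component of the bracket on the six coordinates `symIdx`. -/
def formMat (c : StrIndex 8 → R) (k : Fin 8) : Matrix (Fin 6) (Fin 6) R :=
  .of fun i j => c (symIdx i, symIdx j, k)

/-- The operator relating the two forms of the pencil, multiplied by a determinant. -/
def opMat (c : StrIndex 8 → R) : Matrix (Fin 6) (Fin 6) R :=
  (formMat c 2).adjugate * formMat c 4

/-- Three coordinates of the iterates of the first basis vector under `opMat`. -/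
def krylovMat (c : StrIndex 8 → R) : Matrix (Fin 3) (Fin 3) R :=
  .of fun i j => (opMat c ^ (j : ℕ)) ((![0, 5, 3] : Fin 3 → Fin 6) i) 0

/-- The coefficients of the cubic annihilating `opMat`, multiplied by `det (krylovMat c)`. -/
def krylovCoeff (c : StrIndex 8 → R) : Fin 3 → R :=
  (krylovMat c).adjugate.mulVec fun i => (opMat c ^ 3) ((![0, 5, 3] : Fin 3 → Fin 6) i) 0

/-- The linear coefficient of the depressed cubic of the pencil. -/
def cubicLin (c : StrIndex 8 → R) : R :=
  -(3 * krylovCoeff c 2 ^ 2 + 9 * (krylovMat c).det * krylovCoeff c 1)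

/-- The constant coefficient of the depressed cubic of the pencil. -/
def cubicConst (c : StrIndex 8 → R) : R :=
  -(2 * krylovCoeff c 2 ^ 3 + 9 * (krylovMat c).det * krylovCoeff c 2 * krylovCoeff c 1
    + 27 * (krylovMat c).det ^ 2 * krylovCoeff c 0)

/-- A polynomial in the structure constants whose non-vanishing makes the pencil regular. -/
def regularity (c : StrIndex 8 → R) : R :=
  (formMat c 2).det * (krylovMat c).det * cubicConst c

/-- The discriminant of the Hessian of the cubic of the pencil. -/
def hessianDisc (c : StrIndex 8 → R) : R :=
  81 * cubicConst c ^ 2 + 12 * cubicLin c ^ 3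

variable {S : Type*} [CommRing S] (φ : R →+* S)

/-- Adjugates in place of inverses keep every invariant natural in the ring, so its value at the
generic point is a polynomial. -/
theorem map_opMat_pow (c : StrIndex 8 → R) (n : ℕ) (i j : Fin 6) :
    φ ((opMat c ^ n) i j) = (opMat (φ ∘ c) ^ n) i j := by
  have hf (k : Fin 8) : (formMat c k).map φ = formMat (φ ∘ c) k := rfl
  have h : (opMat c ^ n).map φ = opMat (φ ∘ c) ^ n := by
    rw [← RingHom.mapMatrix_apply, map_pow, opMat, map_mul, RingHom.map_adjugate]
    simp only [RingHom.mapMatrix_apply, hf, opMat]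
  rw [← h, Matrix.map_apply]

theorem map_krylovMat (c : StrIndex 8 → R) : (krylovMat c).map φ = krylovMat (φ ∘ c) := by
  ext i j
  simp [krylovMat, map_opMat_pow]

theorem map_krylovMat_det (c : StrIndex 8 → R) :
    φ (krylovMat c).det = (krylovMat (φ ∘ c)).det := by
  rw [RingHom.map_det, RingHom.mapMatrix_apply, map_krylovMat]

theorem map_krylovCoeff (c : StrIndex 8 → R) (i : Fin 3) :
    φ (krylovCoeff c i) = krylovCoeff (φ ∘ c) i := by
  rw [krylovCoeff, krylovCoeff, RingHom.map_mulVec, ← RingHom.mapMatrix_apply,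
    RingHom.map_adjugate, RingHom.mapMatrix_apply, map_krylovMat]
  simp [Function.comp_def, map_opMat_pow]

theorem map_cubicConst (c : StrIndex 8 → R) : φ (cubicConst c) = cubicConst (φ ∘ c) := by
  simp only [cubicConst, map_neg, map_add, map_mul, map_pow, map_ofNat, map_krylovCoeff,
    map_krylovMat_det]

theorem map_cubicLin (c : StrIndex 8 → R) : φ (cubicLin c) = cubicLin (φ ∘ c) := by
  simp only [cubicLin, map_neg, map_add, map_mul, map_pow, map_ofNat, map_krylovCoeff,
    map_krylovMat_det]

theorem map_regularity (c : StrIndex 8 → R) : φ (regularity c) = regularity (φ ∘ c) := by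
  simp only [regularity, map_mul, map_cubicConst, map_krylovMat_det]
  rw [RingHom.map_det]
  rfl

theorem map_hessianDisc (c : StrIndex 8 → R) : φ (hessianDisc c) = hessianDisc (φ ∘ c) := by
  simp only [hessianDisc, map_add, map_mul, map_pow, map_ofNat, map_cubicConst, map_cubicLin]

end Invariants

/-! ### A sufficient condition for isomorphism with `𝔨_8` -/

section Criterion

variable {K : Type*} [Field K]

/-- The shift `3T - a` removes the quadratic term. The factor `m` will be a Krylov determinant:
Cramer's rule supplies only `m a`, `m b`, `m c` without division. -/
theorem depressed_cubic {V : Type*} [AddCommGroup V] [Module K V] (T : Module.End K V)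
    {m a b c : K} (hT : T ^ 3 = a • T ^ 2 + b • T + c • 1) :
    ((3 * m) • T - (m * a) • 1) ^ 3
      + (-(3 * (m * a) ^ 2 + 9 * m * (m * b))) • ((3 * m) • T - (m * a) • 1)
      + (-(2 * (m * a) ^ 3 + 9 * m * (m * a) * (m * b) + 27 * m ^ 2 * (m * c))) • 1 = 0 := by
  have h : ((3 * m) • T - (m * a) • 1) ^ 3 = (27 * m ^ 3) • T ^ 3 - (27 * m ^ 3 * a) • T ^ 2
      + (9 * m ^ 3 * a ^ 2) • T - (m ^ 3 * a ^ 3) • 1 := by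
    simp only [pow_succ T, pow_zero, pow_succ (_ - _), sub_mul, mul_sub, smul_mul_assoc,
      mul_smul_comm, mul_one, one_mul]
    module
  rw [h, hT]
  module

/-- Cube roots exist in both `ℝ` and `ℂ`, so the square root `s` is the only point where the two
fields differ. -/
theorem TwoNilp.mem_orbit_k8 [CharZero K] (hcube : ∀ x : K, ∃ y, y ^ 3 = x) (ν : TwoNilp K 8)
    (hG : regularity (strConst ν.1) ≠ 0) {s : K} (hs : hessianDisc (strConst ν.1) = s ^ 2)
    (hs0 : s ≠ 0) : ν ∈ (k8 K).orbit := by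
  set c := strConst ν.1 with hc
  obtain ⟨⟨hδ, hm⟩, hr⟩ : ((formMat c 2).det ≠ 0 ∧ (krylovMat c).det ≠ 0) ∧ cubicConst c ≠ 0 := by
    simpa [regularity] using hG
  let ι : (Fin 6 → K) →ₗ[K] Vec K 8 :=
    Fintype.linearCombination K fun i => Pi.single (symIdx i) (1 : K)
  have hform (k : Fin 8) (x y : Fin 6 → K) :
      x ⬝ᵥ (formMat c k).mulVec y = ν.1 (ι x) (ι y) k := by
    simp only [ι, Fintype.linearCombination_apply, map_sum, map_smul, LinearMap.sum_apply,
      LinearMap.smul_apply, Finset.sum_apply, Pi.smul_apply, dotProduct, Matrix.mulVec,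
      formMat, Matrix.of_apply, hc, strConst, Finset.mul_sum, smul_eq_mul]
    rw [Finset.sum_comm]
    exact Finset.sum_congr rfl fun _ _ => Finset.sum_congr rfl fun _ _ => by ring
  let A : LinearMap.BilinForm K (Fin 6 → K) := Matrix.toBilin' (formMat c 2)
  have hA (x y : Fin 6 → K) : A x y = ν.1 (ι x) (ι y) 2 := by
    rw [← hform, ← Matrix.toBilin'_apply']
  have halt : A.IsAlt := fun x => by rw [hA, ν.2.1.alt]; rfl
  have hnd : A.Nondegenerate := LinearMap.BilinForm.nondegenerate_toBilin'_of_det_ne_zero' _ hδ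
  let T : Module.End K (Fin 6 → K) := Matrix.toLin' (opMat c)
  have hAT (x y : Fin 6 → K) : A x (T y) = (formMat c 2).det * ν.1 (ι x) (ι y) 4 := by
    rw [← hform]
    simp only [A, T, Matrix.toBilin'_apply', Matrix.toLin'_apply, opMat]
    rw [Matrix.mulVec_mulVec, ← Matrix.mul_assoc, Matrix.mul_adjugate, Matrix.smul_mul, one_mul,
      Matrix.smul_mulVec, dotProduct_smul, smul_eq_mul]
  -- Self-adjointness expresses that both components of the bracket are alternating.
  have hT (x y : Fin 6 → K) : A (T x) y = A x (T y) := by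
    rw [← LinearMap.IsAlt.neg halt, hAT, hAT, ν.apply_swap (ι y), Pi.neg_apply]
    ring
  let u : Fin 6 → K := Pi.single 0 1
  have hTu (n : ℕ) (i : Fin 6) : (T ^ n) u i = (opMat c ^ n) i 0 := by
    rw [← Matrix.toLin'_pow, Matrix.toLin'_apply, Matrix.mulVec_single_one, Matrix.col_apply]
  have hTu0 (i : Fin 6) : u i = (opMat c ^ 0) i 0 := hTu 0 i
  have hTu1 (i : Fin 6) : T u i = (opMat c ^ 1) i 0 := hTu 1 i
  have hkry (g : Fin 3 → K) (i : Fin 3) : (krylovMat c).mulVec g i =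
      (g 0 • u + g 1 • T u + g 2 • (T ^ 2) u) ((![0, 5, 3] : Fin 3 → Fin 6) i) := by
    simp only [Matrix.mulVec, dotProduct, Fin.sum_univ_three, krylovMat, Matrix.of_apply,
      Pi.add_apply, Pi.smul_apply, hTu, hTu0, hTu1, smul_eq_mul]
    simp only [Fin.val_zero, Fin.val_one, Fin.val_two]
    ring
  have hu : LinearIndependent K ![u, T u, (T ^ 2) u] := by
    rw [Fintype.linearIndependent_iff]
    intro g hg
    rw [Fin.sum_univ_three] at hg
    have hg : g 0 • u + g 1 • T u + g 2 • (T ^ 2) u = 0 := hg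
    refine fun i => congrFun (Matrix.eq_zero_of_mulVec_eq_zero hm (v := g) ?_) i
    ext i
    rw [hkry, hg]
    rfl
  obtain ⟨a, b, e, hcub⟩ := exists_cubic_relation (by simp) halt hnd hT hu
  have hcoef : krylovCoeff c = (krylovMat c).det • ![e, b, a] := by
    have : (fun i => (opMat c ^ 3) ((![0, 5, 3] : Fin 3 → Fin 6) i) 0) =
        (krylovMat c).mulVec ![e, b, a] := by
      ext i
      rw [hkry, ← hTu, hcub]
      refine congrFun (?_ : _ = e • u + b • T u + a • (T ^ 2) u) _
      simp only [LinearMap.add_apply, LinearMap.smul_apply, Module.End.one_apply]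
      module
    rw [krylovCoeff, this, Matrix.mulVec_mulVec, Matrix.adjugate_mul, Matrix.smul_mulVec,
      Matrix.one_mulVec]
  have c0 : krylovCoeff c 0 = (krylovMat c).det * e := by rw [hcoef]; rfl
  have c1 : krylovCoeff c 1 = (krylovMat c).det * b := by rw [hcoef]; rfl
  have c2 : krylovCoeff c 2 = (krylovMat c).det * a := by rw [hcoef]; rfl
  obtain ⟨m, hm'⟩ : ∃ m, m = (krylovMat c).det := ⟨_, rfl⟩
  have hdep := depressed_cubic T (m := m) hcub
  have hq : cubicLin c = -(3 * (m * a) ^ 2 + 9 * m * (m * b)) := by rw [cubicLin, c1, c2, hm']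
  have hr' : cubicConst c =
      -(2 * (m * a) ^ 3 + 9 * m * (m * a) * (m * b) + 27 * m ^ 2 * (m * e)) := by
    rw [cubicConst, c0, c1, c2, hm']
  rw [← hm'] at hm
  rw [← hq, ← hr'] at hdep
  let Q : Module.End K (Fin 6 → K) := (3 * m) • T - (m * a) • 1
  have hQ (x) : Q x = (3 * m) • T x - (m * a) • x := rfl
  have hAQ (x y : Fin 6 → K) : A x (Q y) =
      3 * m * (formMat c 2).det * ν.1 (ι x) (ι y) 4 - m * a * ν.1 (ι x) (ι y) 2 := by
    rw [hQ, map_sub, map_smul, map_smul, hAT, hA, smul_eq_mul, smul_eq_mul]; ring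
  have hQadj (x y : Fin 6 → K) : A (Q x) y = A x (Q y) := by
    simp [hQ, hT]
  have hQu : LinearIndependent K ![u, Q u, (Q ^ 2) u] := by
    rw [Fintype.linearIndependent_iff] at hu ⊢
    intro g hg
    rw [Fin.sum_univ_three] at hg
    have hg : g 0 • u + g 1 • Q u + g 2 • (Q ^ 2) u = 0 := hg
    have hTT : (T ^ 2) u = T (T u) := by rw [pow_two, Module.End.mul_apply]
    have h := hu ![g 0 - g 1 * (m * a) + g 2 * (m * a) ^ 2,
      3 * m * g 1 - 6 * m * (m * a) * g 2, 9 * m ^ 2 * g 2] (by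
        rw [Fin.sum_univ_three, ← hg]
        simp only [Matrix.cons_val, hTT, pow_two Q, Module.End.mul_apply, hQ, map_sub, map_smul]
        module)
    have h2 : g 2 = 0 := by simpa [hm] using h 2
    have h1 : g 1 = 0 := by simpa [hm, h2] using h 1
    have h0 : g 0 = 0 := by simpa [h1, h2] using h 0
    intro i
    fin_cases i
    exacts [h0, h1, h2]
  obtain ⟨α, β, γ, δ, hdet, f, hf⟩ :=
    exists_hexagon hcube halt hnd hQadj hdep hr hs hs0 hQu
  -- `p ξ η` applied to the bracket is the pencil member `ξ A (·, Q ·) + η A`.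
  let p (ξ η : K) : Vec K 8 →ₗ[K] K :=
    (ξ * (3 * m * (formMat c 2).det)) • LinearMap.proj 4 + (η - ξ * (m * a)) • LinearMap.proj 2
  have hp (ξ η : K) (z : Vec K 8) :
      p ξ η z = ξ * (3 * m * (formMat c 2).det * z 4 - m * a * z 2) + η * z 2 := by
    simp [p]; ring
  refine ν.mem_orbit_k8_of_frame (p γ δ) (p α β) (ι ∘ₗ f) (fun z hz h1 h2 => ?_)
    (fun x y => ?_) (fun x y => ?_)
  · rw [hp] at h1 h2
    have h1' : (α * δ - β * γ) * z 2 = 0 := by linear_combination α * h1 - γ * h2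
    have z2 : z 2 = 0 := by simpa [hdet] using h1'
    have h2' : (α * δ - β * γ) * (3 * m * (formMat c 2).det * z 4) = 0 := by
      rw [z2] at h1 h2
      linear_combination δ * h2 - β * h1
    have z4 : z 4 = 0 := by simpa [hdet, hm, hδ] using h2'
    -- With both coordinates zero, the central vector lies in the six-dimensional span, where `A` is
    -- nondegenerate.
    have hιz : ι (z ∘ symIdx) = z := by
      ext i
      simp only [ι, Fintype.linearCombination_apply, Fin.sum_univ_six]
      fin_cases i <;> simp [symIdx, z2, z4]
    have : z ∘ symIdx = 0 := hnd.1 _ fun y => by rw [hA, hιz, hz]; rfl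
    rw [← hιz, this, map_zero]
  · rw [hp, ← (hf x y).1, hAQ, hA]; rfl
  · rw [hp, ← (hf x y).2, hAQ, hA]; rfl

end Criterion

/-! ### The invariants at `𝔨_8` -/

section Values

variable {K : Type*} [Field K]

theorem formMat_k8_two : formMat (strConst (k8 K).1) 2 =
    !![0, -1, 0, 0, 0, 0; 1, 0, 0, 0, 0, 0; 0, 0, 0, -1, 0, 0; 0, 0, 1, 0, 0, 0;
      0, 0, 0, 0, 0, -1; 0, 0, 0, 0, 1, 0] := by
  ext i j
  fin_cases i <;> fin_cases j <;>
    simp [formMat, strConst, k8, k8Bracket_apply, symIdx, dAlpha3, dAlpha5, wedge,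
      Pi.single_apply]

theorem formMat_k8_four : formMat (strConst (k8 K).1) 4 =
    !![0, 0, -1, 0, 0, 0; 0, 0, 0, 0, 0, -1; 1, 0, 0, 0, 0, 0; 0, 0, 0, 0, -1, 0;
      0, 0, 0, 1, 0, 0; 0, 1, 0, 0, 0, 0] := by
  ext i j
  fin_cases i <;> fin_cases j <;>
    simp [formMat, strConst, k8, k8Bracket_apply, symIdx, dAlpha3, dAlpha5, wedge,
      Pi.single_apply]

/-- The matrix of the first form squares to `-1`, which gives its adjugate and `d ^ 2 = 1` without
expanding a determinant of size six; the sign of `d` is never needed. -/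
theorem k8_invariants : ∃ d : K, d ^ 2 = 1 ∧ (formMat (strConst (k8 K).1) 2).det = d ∧
    (krylovMat (strConst (k8 K).1)).det = d ∧ krylovCoeff (strConst (k8 K).1) = ![-1, 0, 0] := by
  set c := strConst (k8 K).1 with hc
  have hAA : formMat c 2 * formMat c 2 = -1 := by
    rw [formMat_k8_two]
    ext i j
    fin_cases i <;> fin_cases j <;> simp [Matrix.mul_apply, Fin.sum_univ_six]
  have hdd : (formMat c 2).det ^ 2 = 1 := by
    rw [pow_two, ← Matrix.det_mul, hAA, Matrix.det_neg, Matrix.det_one]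
    norm_num
  obtain ⟨d, hd⟩ : ∃ d, d = (formMat c 2).det := ⟨_, rfl⟩
  rw [← hd] at hdd
  have hadj : (formMat c 2).adjugate = (-d) • formMat c 2 := by
    have h := congrArg ((formMat c 2).adjugate * ·) hAA
    simp only [← mul_assoc, Matrix.adjugate_mul, ← hd, Matrix.smul_mul, one_mul, mul_neg,
      mul_one] at h
    rw [neg_smul, h, neg_neg]
  have hop : opMat c = (-d) • !![0, 0, 0, 0, 0, 1; 0, 0, -1, 0, 0, 0; 0, 0, 0, 0, 1, 0;
      1, 0, 0, 0, 0, 0; 0, -1, 0, 0, 0, 0; 0, 0, 0, 1, 0, 0] := by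
    rw [opMat, hadj, Matrix.smul_mul, formMat_k8_two, formMat_k8_four]
    congr 1
    ext i j
    fin_cases i <;> fin_cases j <;> simp [Matrix.mul_apply, Fin.sum_univ_six]
  have h1 (i : Fin 6) : (opMat c ^ 1) i 0 = ![0, 0, 0, -d, 0, 0] i := by
    rw [pow_one, hop]
    fin_cases i <;> simp
  have hs (n : ℕ) (i : Fin 6) : (opMat c ^ (n + 1)) i 0 = ∑ j, opMat c i j * (opMat c ^ n) j 0 := by
    rw [pow_succ', Matrix.mul_apply]
  have h2 (i : Fin 6) : (opMat c ^ 2) i 0 = ![0, 0, 0, 0, 0, 1] i := by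
    rw [hs, Fin.sum_univ_six]
    simp only [h1]
    rw [hop]
    fin_cases i <;> simp
    rw [← pow_two, hdd]
  have h3 (i : Fin 6) : (opMat c ^ 3) i 0 = ![-d, 0, 0, 0, 0, 0] i := by
    rw [hs, Fin.sum_univ_six]
    simp only [h2]
    rw [hop]
    fin_cases i <;> simp
  -- The iterates of the first basis vector are multiples of the vectors with indices 0, 3, 5, which
  -- explains the rows chosen in `krylovMat`.
  have hkry : krylovMat c = !![1, 0, 0; 0, 0, 1; 0, -d, 0] := by
    ext i j
    fin_cases j
    · fin_cases i <;> simp [krylovMat]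
    · fin_cases i <;> simp only [krylovMat, Matrix.of_apply] <;> exact h1 _
    · fin_cases i <;> simp only [krylovMat, Matrix.of_apply] <;> exact h2 _
  refine ⟨d, hdd, hd.symm, ?_, ?_⟩
  · rw [hkry, Matrix.det_fin_three]; simp
  · simp only [krylovCoeff, h3, hkry, Matrix.adjugate_fin_three]
    ext i
    fin_cases i <;> simp [Matrix.mulVec, dotProduct, Fin.sum_univ_three]
    rw [← pow_two, hdd]

theorem regularity_k8 [CharZero K] : regularity (strConst (k8 K).1) ≠ 0 := by
  obtain ⟨d, hd, h1, h2, h3⟩ := k8_invariants (K := K)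
  have : regularity (strConst (k8 K).1) = 27 * (d ^ 2) ^ 2 := by
    simp only [regularity, cubicConst, h1, h2, h3, Matrix.cons_val]
    ring
  rw [this, hd]
  norm_num

theorem hessianDisc_k8 : hessianDisc (strConst (k8 K).1) = 243 ^ 2 := by
  obtain ⟨d, hd, h1, h2, h3⟩ := k8_invariants (K := K)
  simp only [hessianDisc, cubicConst, cubicLin, h2, h3, hd, Matrix.cons_val]
  norm_num

end Values

/-! ### Openness of the orbit -/

section Topology

variable {K : Type*} [Field K]

theorem TwoNilp.isOpen_zariski_ne_zero {n : ℕ} (p : MvPolynomial (StrIndex n) K) :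
    IsOpen[TwoNilp.zariski K n] {ν | MvPolynomial.eval (strConst ν.1) p ≠ 0} := by
  let := zariskiAffine (StrIndex n) K
  refine isOpen_induced_iff.2 ⟨{x | MvPolynomial.eval x p ≠ 0}, ?_, rfl⟩
  exact ⟨{p}, by ext x; simp⟩

/-- The action of `GL(K^n)` on `2Nilp_n`. -/
def TwoNilp.act {n : ℕ} (g : Vec K n ≃ₗ[K] Vec K n) (ν : TwoNilp K n) : TwoNilp K n :=
  ⟨(ν.1.compl₁₂ g.symm.toLinearMap g.symm.toLinearMap).compr₂ g.toLinearMap,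
    ⟨fun x => by simp [ν.2.1.alt], fun x y z => by
      simp [← map_add, ν.2.1.jacobi]⟩,
    fun x y z => by simp [ν.2.2]⟩

theorem TwoNilp.act_apply {n : ℕ} (g : Vec K n ≃ₗ[K] Vec K n) (ν : TwoNilp K n) (x y : Vec K n) :
    (ν.act g).1 x y = g (ν.1 (g.symm x) (g.symm y)) := rfl

/-- The structure constants of `ν.act g` as polynomials in those of `ν`. -/
noncomputable def actPoly {n : ℕ} (g : Vec K n ≃ₗ[K] Vec K n) (t : StrIndex n) : MvPolynomial (StrIndex n) K :=
  ∑ i, ∑ j, ∑ k, MvPolynomial.C (g.symm (Pi.single t.1 1) i * g.symm (Pi.single t.2.1 1) j *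
    g (Pi.single k 1) t.2.2) * MvPolynomial.X (i, j, k)

theorem strConst_act {n : ℕ} (g : Vec K n ≃ₗ[K] Vec K n) (ν : TwoNilp K n) (t : StrIndex n) :
    strConst (ν.act g).1 t = MvPolynomial.eval (strConst ν.1) (actPoly g t) := by
  have hexp (x : Vec K n) : x = ∑ i, x i • Pi.single i 1 := pi_eq_sum_univ' x
  rw [strConst, TwoNilp.act_apply, hexp (g.symm (Pi.single t.1 1)),
    hexp (g.symm (Pi.single t.2.1 1))]
  simp only [map_sum, map_smul, LinearMap.sum_apply, LinearMap.smul_apply, Finset.sum_apply,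
    Pi.smul_apply, smul_eq_mul, actPoly, Finset.mul_sum, map_mul, MvPolynomial.eval_C, MvPolynomial.eval_X]
  rw [Finset.sum_comm]
  refine Finset.sum_congr rfl fun i _ => Finset.sum_congr rfl fun j _ => ?_
  conv_lhs => rw [hexp (ν.1 (Pi.single i 1) (Pi.single j 1))]
  simp only [map_sum, map_smul, Finset.sum_apply, Pi.smul_apply, smul_eq_mul, Finset.mul_sum,
    strConst]
  exact Finset.sum_congr rfl fun k _ => by ring

theorem TwoNilp.continuous_act_zariski {n : ℕ} (g : Vec K n ≃ₗ[K] Vec K n) :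
    @Continuous _ _ (TwoNilp.zariski K n) (TwoNilp.zariski K n) (TwoNilp.act g) := by
  let := zariskiAffine (StrIndex n) K
  let := TwoNilp.zariski K n
  refine continuous_induced_rng.2 ⟨fun s hs => ?_⟩
  obtain ⟨S, hS⟩ : ∃ S : Set (MvPolynomial (StrIndex n) K),
      sᶜ = {x | ∀ p ∈ S, MvPolynomial.eval x p = 0} := hs
  have : (fun ν => strConst ν.1) ∘ TwoNilp.act g ⁻¹' s =
      ⋃ p ∈ S, {ν | MvPolynomial.eval (strConst ν.1) (MvPolynomial.bind₁ (actPoly g) p) ≠ 0} := by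
    ext ν
    have h : strConst (ν.act g).1 ∈ sᶜ ↔
        ∀ p ∈ S, MvPolynomial.eval (strConst (ν.act g).1) p = 0 := by rw [hS]; rfl
    have h' := not_congr h
    rw [Set.notMem_compl_iff] at h'
    have hact : strConst (ν.act g).1 =
        fun t => MvPolynomial.eval (strConst ν.1) (actPoly g t) := funext (strConst_act g ν)
    rw [Set.mem_preimage, Function.comp_apply, h', hact]
    simp only [not_forall, Set.mem_iUnion, Set.mem_ofPred_eq, exists_prop, ne_eq,
      MvPolynomial.eval, MvPolynomial.eval₂Hom_bind₁]
  rw [this]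
  exact isOpen_biUnion fun p _ => TwoNilp.isOpen_zariski_ne_zero _

theorem TwoNilp.continuous_act_classical [TopologicalSpace K] [IsTopologicalRing K] {n : ℕ}
    (g : Vec K n ≃ₗ[K] Vec K n) :
    @Continuous _ _ (TwoNilp.classical K n) (TwoNilp.classical K n) (TwoNilp.act g) := by
  let := TwoNilp.classical K n
  refine continuous_induced_rng.2 (continuous_pi fun t => ?_)
  simp only [Function.comp_apply, strConst_act]
  exact (MvPolynomial.continuous_eval _).comp continuous_induced_dom

/-- The orbit is covered by the translates of `O`, each open because the inverse group element acts
continuously. -/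
theorem TwoNilp.isOpen_orbit_of_subset {n : ℕ} [TopologicalSpace (TwoNilp K n)]
    (hact : ∀ g, Continuous (TwoNilp.act (K := K) (n := n) g)) {μ : TwoNilp K n}
    {O : Set (TwoNilp K n)} (hO : IsOpen O) (hμ : μ ∈ O) (hsub : O ⊆ μ.orbit) :
    IsOpen μ.orbit := by
  refine isOpen_iff_forall_mem_open.2 fun ν ⟨g, hg⟩ =>
    ⟨TwoNilp.act g.symm ⁻¹' O, fun ν' hν' => ?_, hO.preimage (hact _), ?_⟩
  · obtain ⟨h, hh⟩ := hsub hν'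
    refine ⟨h.trans g, fun x y => ?_⟩
    have := hh (g.symm x) (g.symm y)
    rw [TwoNilp.act_apply] at this
    simpa [LinearEquiv.symm_apply_eq] using this
  · have : ν.act g.symm = μ := by
      refine Subtype.ext (LinearMap.ext₂ fun x y => ?_)
      rw [TwoNilp.act_apply, hg]
      simp
    rwa [Set.mem_preimage, this]

/-- An expression natural in the ring, taken at the generic point, is a polynomial that evaluates
to it. -/
theorem eval_generic {n : ℕ} {f : ∀ {R : Type _} [CommRing R], (StrIndex n → R) → R}
    (hf : ∀ {R S : Type _} [CommRing R] [CommRing S] (φ : R →+* S) (c : StrIndex n → R),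
      φ (f c) = f (φ ∘ c)) (x : StrIndex n → K) :
    MvPolynomial.eval x (f MvPolynomial.X) = f x := by
  rw [hf]
  congr
  ext t
  simp

theorem isOpen_zariski_orbit_k8 [CharZero K] [IsAlgClosed K] :
    IsOpen[TwoNilp.zariski K 8] (k8 K).orbit := by
  let := TwoNilp.zariski K 8
  refine TwoNilp.isOpen_orbit_of_subset TwoNilp.continuous_act_zariski
    (TwoNilp.isOpen_zariski_ne_zero
      (regularity MvPolynomial.X * hessianDisc MvPolynomial.X)) ?_ fun ν hν => ?_
  · simp only [Set.mem_ofPred_eq, map_mul]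
    rw [eval_generic map_regularity, eval_generic map_hessianDisc, hessianDisc_k8]
    exact mul_ne_zero regularity_k8 (by norm_num)
  · simp only [Set.mem_ofPred_eq, map_mul] at hν
    rw [eval_generic map_regularity, eval_generic map_hessianDisc] at hν
    obtain ⟨s, hs⟩ := IsAlgClosed.exists_pow_nat_eq (hessianDisc (strConst ν.1)) two_pos
    refine ν.mem_orbit_k8 (fun x => IsAlgClosed.exists_pow_nat_eq x three_pos)
      (left_ne_zero_of_mul hν) hs.symm ?_
    rintro rfl
    exact right_ne_zero_of_mul hν (by rw [← hs]; ring)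

theorem TwoNilp.classical_le_zariski [TopologicalSpace K] [IsTopologicalRing K] [T1Space K]
    (n : ℕ) : TwoNilp.classical K n ≤ TwoNilp.zariski K n := by
  refine induced_mono fun s hs => ?_
  obtain ⟨S, hS⟩ : ∃ S : Set (MvPolynomial (StrIndex n) K),
      sᶜ = {x | ∀ p ∈ S, MvPolynomial.eval x p = 0} := hs
  rw [← isClosed_compl_iff, hS]
  simp only [Set.ofPred_forall]
  exact isClosed_biInter fun p _ =>
    isClosed_singleton.preimage (MvPolynomial.continuous_eval p)

theorem exists_cube_root_real (x : ℝ) : ∃ y, y ^ 3 = x := by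
  rcases le_total 0 x with h | h
  · exact ⟨_, Real.rpow_inv_natCast_pow h three_ne_zero⟩
  · refine ⟨-(-x) ^ ((3 : ℕ)⁻¹ : ℝ), ?_⟩
    rw [Odd.neg_pow (by decide), Real.rpow_inv_natCast_pow (neg_nonneg.2 h) three_ne_zero, neg_neg]

theorem isOpen_classical_orbit_k8_real : IsOpen[TwoNilp.classical ℝ 8] (k8 ℝ).orbit := by
  let := TwoNilp.classical ℝ 8
  have hcont (p : MvPolynomial (StrIndex 8) ℝ) :
      Continuous fun ν : TwoNilp ℝ 8 => MvPolynomial.eval (strConst ν.1) p :=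
    (MvPolynomial.continuous_eval p).comp continuous_induced_dom
  -- The Hessian discriminant is `-3` times the discriminant of the cubic, so positivity means a
  -- single real root, which is simple.
  refine TwoNilp.isOpen_orbit_of_subset TwoNilp.continuous_act_classical
    ((isOpen_ne (x := (0 : ℝ)) |>.preimage (hcont (regularity MvPolynomial.X))).inter
      (isOpen_Ioi (a := (0 : ℝ)) |>.preimage (hcont (hessianDisc MvPolynomial.X)))) ⟨?_, ?_⟩
    fun ν ⟨h1, h2⟩ => ?_
  · rw [Set.mem_preimage, eval_generic map_regularity]
    exact regularity_k8
  · rw [Set.mem_preimage, eval_generic map_hessianDisc, hessianDisc_k8]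
    norm_num
  · rw [Set.mem_preimage, eval_generic map_regularity] at h1
    rw [Set.mem_preimage, eval_generic map_hessianDisc, Set.mem_Ioi] at h2
    exact ν.mem_orbit_k8 exists_cube_root_real h1 (Real.sq_sqrt h2.le).symm
      (Real.sqrt_pos.2 h2).ne'

end Topology

theorem mainTheorem7 :
    IsOpen[TwoNilp.zariski ℂ 8] (k8 ℂ).orbit ∧
    IsOpen[TwoNilp.classical ℂ 8] (k8 ℂ).orbit ∧
    IsOpen[TwoNilp.classical ℝ 8] (k8 ℝ).orbit :=
  ⟨isOpen_zariski_orbit_k8, TwoNilp.classical_le_zariski 8 _ isOpen_zariski_orbit_k8,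
    isOpen_classical_orbit_k8_real⟩
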